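/- **Corollary (Avram/Parter).** Let $\mathbb T$ be the complex unit circle and, for $a \in L^\infty(\mathbb T)$ (complex-valued), let $a_k := \frac{1}{2\pi}\int_0^{2\pi} a(e^{it}) e^{-ikt}\,dt$ be its Fourier coefficients. Let $L(a)$ be the Laurent operator on $\ell^2(\mathbb Z)$ with matrix $(a_{i-j})_{i,j\in\mathbb Z}$ and let $T(a)$ be the Toeplitz operator on $\ell^2(\mathbb Z^+)$, $\mathbb Z^+=\{0,1,2,\dots\}$, obtained by compressing $L(a)$, so that $T(a)$ has the matrix $(a_{i-j})_{i,j\ge 0}$. For $n \ge 1$ let $P_n$ be the orthogonal projection of $\ell^2(\mathbb Z^+)$ onto the sequences supported on $\{0,\dots,n-1\}$, and regard $A_n := P_nT(a)P_n$ as an operator on $\operatorname{im} P_n \cong \mathbb C^n$. Let $\mathcal F$ be the $C^*$-algebra, with entrywise operations and the supremum norm, of all sequences $(B_n)_{n\ge1}$ of operators $B_n : \operatorname{im}P_n\to\operatorname{im}P_n$ for which the strong limits of $B_nP_n$ and $B_n^*P_n$ on $\ell^2(\mathbb Z^+)$ exist (such sequences are bounded), and let $\mathcal G$ be the closed ideal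 of those sequences in $\mathcal F$ with $\|B_n\|\to 0$. The stability spectrum of $\mathbf B\in\mathcal F$ is the spectrum $\sigma(\mathbf B+\mathcal G)$ of the coset $\mathbf B+\mathcal G$ in $\mathcal F/\mathcal G$. Let $a\in L^\infty(\mathbb T)$. Then $\mathbf A := (P_nT(a)P_n)_{n\ge1}$ belongs to $\mathcal F$. Put $\mathbf B := (\mathbf A^*\mathbf A)^{1/2}\in\mathcal F$, and let $g$ be any complex-valued function that is continuous on a neighborhood in $\mathbb R$ of the stability spectrum $\sigma(\mathbf B+\mathcal G)$. Then $t\mapsto g(|a(e^{it})|)$ is integrable on $[0,2\pi]$ and $$\lim_{n\to\infty}\frac{g(\sigma_1(A_n))+\dots+g(\sigma_n(A_n))}{n}=\frac1{2\pi}\int_0^{2\pi} g(|a(e^{it})|)\,dt,$$ where $\sigma_1(A_n),\dots,\sigma_n(A_n)$ are the singular values of $A_n$, counted with multiplicity. (For large $n$ they lie in the neighborhood on which $g$ is continuous; the values of $g$ elsewhere are irrelevant.) -/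

import Mathlib

open Filter Topology MeasureTheory Real
open scoped ENNReal

namespace FiniteSections

noncomputable section

/-- The Hilbert space `ℓ²(ℤ)`. -/
abbrev L2Z : Type := lp (fun _ : ℤ => ℂ) 2

/-- The Hilbert space `ℓ²(ℤ⁺)`, where `ℤ⁺ = {0, 1, 2, …}`. -/
abbrev L2N : Type := lp (fun _ : ℕ => ℂ) 2

/-- The space `im P_n = ℓ²({0, …, n-1})`, that is, `ℂⁿ` with the Euclidean norm. -/
abbrev Im (n : ℕ+) : Type := EuclideanSpace ℂ (Fin (n : ℕ))

/-- The `C*`-algebra `L(im P_n)`. -/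
abbrev Op (n : ℕ+) : Type := Im n →L[ℂ] Im n

instance factTwoPiPos : Fact (0 < 2 * π) := ⟨Real.two_pi_pos⟩

/-- `L^∞(𝕋)`; the unit circle is parametrized by `t ↦ e^{it}`, `t ∈ ℝ / 2πℤ`. -/
abbrev LInfty : Type := Lp ℂ ∞ (AddCircle.haarAddCircle : Measure (AddCircle (2 * π)))

/-- The Hilbert space `L²(𝕋)`. -/
abbrev LTwo : Type := Lp ℂ 2 (AddCircle.haarAddCircle : Measure (AddCircle (2 * π)))

/-! ### Laurent and Toeplitz operators -/

/-- Multiplication by `a ∈ L^∞(𝕋)` on `L²(𝕋)`. -/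
def mulOp (a : LInfty) : LTwo →L[ℂ] LTwo :=
  (ContinuousLinearMap.mul ℂ ℂ).holderL AddCircle.haarAddCircle ∞ 2 2 a

/-- The Laurent operator `L(a)` on `ℓ²(ℤ)`: multiplication by `a`, transported to `ℓ²(ℤ)` by the
Fourier transform. -/
def laurent (a : LInfty) : L2Z →L[ℂ] L2Z :=
  fourierBasis.repr.toLinearIsometry.toContinuousLinearMap ∘L mulOp a ∘L
    fourierBasis.repr.symm.toLinearIsometry.toContinuousLinearMap

/-- The matrix representation of `L(a)` with respect to the standard basis of `ℓ²(ℤ)` is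
`(a_{i-j})`, where `a_k` is the `k`th Fourier coefficient of `a`. -/
theorem laurent_single_apply (a : LInfty) (i j : ℤ) :
    laurent a (lp.single 2 j 1) i = fourierCoeff (a : AddCircle (2 * π) → ℂ) (i - j) := by
  classical
  have h1 : fourierBasis.repr.symm (lp.single 2 j (1 : ℂ))
      = (fourierLp 2 j : LTwo) := by
    rw [HilbertBasis.repr_symm_single, coe_fourierBasis]
  have h2 : laurent a (lp.single 2 j 1) = fourierBasis.repr (mulOp a (fourierLp 2 j)) := by
    rw [← h1]; rfl
  rw [h2, fourierBasis_repr]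
  unfold fourierCoeff
  refine integral_congr_ae ?_
  have h3 : (mulOp a (fourierLp 2 j) : AddCircle (2 * π) → ℂ) =ᵐ[AddCircle.haarAddCircle]
      fun t => a t * (fourierLp 2 j : LTwo) t :=
    ContinuousLinearMap.coeFn_holder (ContinuousLinearMap.mul ℂ ℂ) a (fourierLp 2 j : LTwo)
  filter_upwards [h3, coeFn_fourierLp 2 j] with t ht1 ht2
  rw [ht1, ht2, neg_sub, sub_eq_neg_add, fourier_add]
  simp only [smul_eq_mul]
  ring

theorem memlp_restrict (x : L2Z) : Memℓp (fun k : ℕ => x (k : ℤ)) 2 := by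
  have h := (memℓp_gen_iff (p := 2) (by norm_num)).1 (lp.memℓp x)
  exact (memℓp_gen_iff (by norm_num)).2 (h.comp_injective Nat.cast_injective)

/-- The restriction `ℓ²(ℤ) → ℓ²(ℤ⁺)`, i.e. the projection `P` as an operator onto its range. -/
def restrict : L2Z →L[ℂ] L2N :=
  LinearMap.mkContinuous
    { toFun := fun x => ⟨fun k : ℕ => x (k : ℤ), memlp_restrict x⟩
      map_add' := fun _ _ => rfl
      map_smul' := fun _ _ => rfl } 1 (by
    intro x
    rw [one_mul]
    have hp : 0 < (2 : ℝ≥0∞).toReal := by norm_num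
    refine (Real.rpow_le_rpow_iff (norm_nonneg _) (norm_nonneg _) hp).1 ?_
    rw [lp.norm_rpow_eq_tsum hp, lp.norm_rpow_eq_tsum hp]
    exact tsum_comp_le_tsum_of_inj ((memℓp_gen_iff hp).1 (lp.memℓp x))
      (fun _ => by positivity) Nat.cast_injective)

theorem restrict_apply (x : L2Z) (k : ℕ) : restrict x k = x (k : ℤ) := rfl

/-- The Toeplitz operator `T(a) = P L(a) P` on `ℓ²(ℤ⁺)`; the adjoint of `restrict` is the
extension by zero. -/
def toeplitz (a : LInfty) : L2N →L[ℂ] L2N :=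
  restrict ∘L laurent a ∘L restrict.adjoint

theorem toeplitz_single_apply (a : LInfty) (i j : ℕ) :
    toeplitz a (lp.single 2 j 1) i
      = fourierCoeff (a : AddCircle (2 * π) → ℂ) ((i : ℤ) - (j : ℤ)) := by
  classical
  have h : restrict.adjoint (lp.single 2 j (1 : ℂ)) = lp.single 2 (j : ℤ) (1 : ℂ) := by
    refine ext_inner_right ℂ fun y => ?_
    rw [ContinuousLinearMap.adjoint_inner_left, lp.inner_single_left, lp.inner_single_left,
      restrict_apply]
  rw [← laurent_single_apply, ← h]
  rfl

/-! ### Finite sections -/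

/-- The projection `P_n` as an operator from `ℓ²(ℤ⁺)` onto its range `im P_n`:
`x ↦ (x_0, …, x_{n-1})`. -/
def proj (n : ℕ+) : L2N →L[ℂ] Im n :=
  ((EuclideanSpace.equiv (Fin (n : ℕ)) ℂ).symm : (Fin (n : ℕ) → ℂ) →L[ℂ] Im n) ∘L
    ContinuousLinearMap.pi (fun i : Fin (n : ℕ) => lp.evalCLM ℂ (fun _ : ℕ => ℂ) 2 (i : ℕ))

theorem proj_apply (n : ℕ+) (x : L2N) (i : Fin (n : ℕ)) : proj n x i = x (i : ℕ) := rfl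

/-- The inclusion of `im P_n` into `ℓ²(ℤ⁺)`. -/
def incl (n : ℕ+) : Im n →L[ℂ] L2N := (proj n).adjoint

theorem incl_apply (n : ℕ+) (x : Im n) (k : ℕ) :
    incl n x k = if h : k < (n : ℕ) then x ⟨k, h⟩ else 0 := by
  classical
  have h1 : incl n x k = inner ℂ (lp.single 2 k (1 : ℂ) : L2N) (incl n x) := by
    rw [lp.inner_single_left]; simp
  rw [h1, incl, ContinuousLinearMap.adjoint_inner_right, PiLp.inner_apply]
  simp only [proj_apply, lp.single_apply]
  split_ifs with h
  · rw [Finset.sum_eq_single ⟨k, h⟩]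
    · simp
    · intro i _ hi
      have : (i : ℕ) ≠ k := fun h' => hi (Fin.ext h')
      simp [Pi.single_eq_of_ne this]
    · simp
  · refine Finset.sum_eq_zero fun i _ => ?_
    have : (i : ℕ) ≠ k := fun h' => h (h' ▸ i.2)
    simp [Pi.single_eq_of_ne this]

/-- The finite section `P_n A P_n : im P_n → im P_n`. -/
def finSection (A : L2N →L[ℂ] L2N) (n : ℕ+) : Op n := proj n ∘L A ∘L incl n
theorem proj_incl (n : ℕ+) (x : Im n) : proj n (incl n x) = x := by
  ext i
  simp [proj_apply, incl_apply]

theorem norm_proj_le (n : ℕ+) : ‖proj n‖ ≤ 1 := by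
  refine ContinuousLinearMap.opNorm_le_bound _ zero_le_one fun x => ?_
  have hp : 0 < (2 : ℝ≥0∞).toReal := by norm_num
  rw [one_mul, EuclideanSpace.norm_eq]
  refine Real.sqrt_le_iff.2 ⟨norm_nonneg _, ?_⟩
  have h := lp.norm_rpow_eq_tsum hp x
  have hs := (memℓp_gen_iff hp).1 (lp.memℓp x)
  simp only [ENNReal.toReal_ofNat, Real.rpow_ofNat] at h hs
  rw [h]
  simp only [proj_apply]
  rw [Fin.sum_univ_eq_sum_range (fun i => ‖x i‖ ^ 2)]
  exact hs.sum_le_tsum _ (fun _ _ => by positivity)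

theorem tendsto_incl_proj (x : L2N) :
    Tendsto (fun n : ℕ+ => incl n (proj n x)) atTop (𝓝 x) := by
  classical
  have h1 := (lp.hasSum_single (p := 2) (by norm_num) x).tendsto_sum_nat
  refine (h1.comp tendsto_PNat_val_atTop_atTop).congr fun n => ?_
  ext k
  rw [incl_apply, Function.comp_apply, lp.coeFn_sum, Finset.sum_apply]
  simp only [lp.single_apply, proj_apply]
  rw [Finset.sum_pi_single]
  simp

/-! ### The algebra of sequences with strong limits -/

/-- The `C*`-algebra of all bounded sequences `(A_n)` with `A_n ∈ L(im P_n)`, with entrywise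
operations and the supremum norm. -/
def BddSeq : Type := lp Op ∞

instance instCStarOp (n : ℕ+) : CStarAlgebra (Op n) := inferInstance

instance instNormOneOp (n : ℕ+) : NormOneClass (Op n) := inferInstance

/-- The `C*`-algebra structure of an `ℓ^∞`-product of unital `C*`-algebras. -/
def lpCStarAlgebra {I : Type*} (A : I → Type*) [∀ i, CStarAlgebra (A i)]
    [∀ i, NormOneClass (A i)] : CStarAlgebra (lp A ∞) where
  __ := lp.inftyNormedRing
  __ := lp.inftyNormedAlgebra
  __ := (inferInstance : NonUnitalCStarAlgebra (lp A ∞))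

instance instCStarBddSeq : CStarAlgebra BddSeq := lpCStarAlgebra Op

namespace BddSeq

/-- The `n`th entry of a sequence. -/
def entry (A : BddSeq) (n : ℕ+) : Op n := (show lp Op ∞ from A) n

instance : CoeFun BddSeq (fun _ => ∀ n : ℕ+, Op n) := ⟨entry⟩

theorem ext {A B : BddSeq} (h : ∀ n, A n = B n) : A = B := lp.ext (funext h)

theorem add_apply (A B : BddSeq) (n : ℕ+) : (A + B) n = A n + B n := rfl

theorem sub_apply (A B : BddSeq) (n : ℕ+) : (A - B) n = A n - B n := rfl

theorem mul_apply (A B : BddSeq) (n : ℕ+) : (A * B) n = A n * B n := rfl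

theorem star_apply (A : BddSeq) (n : ℕ+) : (star A) n = star (A n) := rfl

theorem zero_apply (n : ℕ+) : (0 : BddSeq) n = 0 := rfl

theorem algebraMap_apply (c : ℂ) (n : ℕ+) :
    (algebraMap ℂ BddSeq c) n = algebraMap ℂ (Op n) c := rfl

theorem norm_apply_le (A : BddSeq) (n : ℕ+) : ‖A n‖ ≤ ‖A‖ :=
  lp.norm_apply_le_norm ENNReal.top_ne_zero (show lp Op ∞ from A) n

theorem norm_eq_iSup (A : BddSeq) : ‖A‖ = ⨆ n, ‖A n‖ := lp.norm_eq_ciSup (show lp Op ∞ from A)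

end BddSeq

/-- `W` is the strong limit of the operators `A_n P_n` on `ℓ²(ℤ⁺)`. -/
def StrongLim (A : ∀ n, Op n) (W : L2N →L[ℂ] L2N) : Prop :=
  ∀ x : L2N, Tendsto (fun n : ℕ+ => incl n (A n (proj n x))) atTop (𝓝 (W x))

theorem norm_incl_le (n : ℕ+) : ‖incl n‖ ≤ 1 := by
  rw [incl, LinearIsometryEquiv.norm_map]
  exact norm_proj_le n

theorem norm_compress_le (A : BddSeq) (n : ℕ+) (x : L2N) :
    ‖incl n (A n (proj n x))‖ ≤ ‖A‖ * ‖x‖ := by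
  have h1 := (incl n).le_of_opNorm_le (norm_incl_le n) (A n (proj n x))
  have h2 := (A n).le_of_opNorm_le (A.norm_apply_le n) (proj n x)
  have h3 := (proj n).le_of_opNorm_le (norm_proj_le n) x
  rw [one_mul] at h1 h3
  exact h1.trans (h2.trans (mul_le_mul_of_nonneg_left h3 (norm_nonneg _)))

theorem strongLim_mul {A B : BddSeq} {V W : L2N →L[ℂ] L2N} (hA : StrongLim A V)
    (hB : StrongLim B W) : StrongLim (A * B).entry (V * W) := by
  intro x
  have h1 := hA (W x)
  have h2 : Tendsto (fun n : ℕ+ => incl n (A n (proj n (incl n (B n (proj n x)) - W x))))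
      atTop (𝓝 0) := by
    have h3 : Tendsto (fun n : ℕ+ => ‖A‖ * ‖incl n (B n (proj n x)) - W x‖) atTop (𝓝 0) := by
      simpa using (tendsto_iff_norm_sub_tendsto_zero.1 (hB x)).const_mul ‖A‖
    exact squeeze_zero_norm (fun n => norm_compress_le A n _) h3
  have h4 := h2.add h1
  rw [zero_add] at h4
  refine h4.congr fun n => ?_
  rw [map_sub, map_sub, map_sub, sub_add_cancel, proj_incl]
  rfl

theorem strongLim_add {A B : BddSeq} {V W : L2N →L[ℂ] L2N} (hA : StrongLim A V)
    (hB : StrongLim B W) : StrongLim (A + B).entry (V + W) := by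
  intro x
  refine ((hA x).add (hB x)).congr fun n => ?_
  rw [← map_add]
  rfl

theorem strongLim_algebraMap (c : ℂ) :
    StrongLim (algebraMap ℂ BddSeq c).entry (algebraMap ℂ (L2N →L[ℂ] L2N) c) := by
  intro x
  have h : (algebraMap ℂ (L2N →L[ℂ] L2N) c) x = c • x := by
    simp [Algebra.algebraMap_eq_smul_one]
  rw [h]
  refine ((tendsto_incl_proj x).const_smul c).congr fun n => ?_
  rw [BddSeq.algebraMap_apply, Algebra.algebraMap_eq_smul_one]
  simp

/-- The algebra `𝓕` of all sequences `(A_n)` for which the strong limits of `A_n P_n` and of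
`A_n^* P_n` exist. -/
def seqAlg : StarSubalgebra ℂ BddSeq where
  carrier := {A | (∃ W, StrongLim A W) ∧ ∃ W, StrongLim (star A).entry W}
  mul_mem' {A B} := by
    rintro ⟨⟨V, hV⟩, V', hV'⟩ ⟨⟨W, hW⟩, W', hW'⟩
    exact ⟨⟨_, strongLim_mul hV hW⟩, _, by rw [star_mul]; exact strongLim_mul hW' hV'⟩
  add_mem' {A B} := by
    rintro ⟨⟨V, hV⟩, V', hV'⟩ ⟨⟨W, hW⟩, W', hW'⟩
    exact ⟨⟨_, strongLim_add hV hW⟩, _, by rw [star_add]; exact strongLim_add hV' hW'⟩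
  algebraMap_mem' c :=
    ⟨⟨_, strongLim_algebraMap c⟩, _, by rw [← algebraMap_star_comm]; exact strongLim_algebraMap _⟩
  star_mem' {A} := by
    rintro ⟨h, h'⟩
    exact ⟨h', by rwa [star_star]⟩

theorem exists_strongLim_of_approx (A : BddSeq)
    (h : ∀ ε > 0, ∃ B : BddSeq, (∃ W, StrongLim B.entry W) ∧ ‖A - B‖ < ε) :
    ∃ W, StrongLim A.entry W := by
  have hc : ∀ x : L2N, CauchySeq (fun n : ℕ+ => incl n (A n (proj n x))) := by
    intro x
    rw [Metric.cauchySeq_iff]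
    intro ε hε
    obtain ⟨B, ⟨W, hW⟩, hB⟩ := h (ε / (3 * (‖x‖ + 1))) (by positivity)
    obtain ⟨N, hN⟩ := Metric.cauchySeq_iff.1 (hW x).cauchySeq (ε / 3) (by positivity)
    have key : ∀ n : ℕ+, dist (incl n (A n (proj n x))) (incl n (B n (proj n x))) < ε / 3 := by
      intro n
      have h1 := norm_compress_le (A - B) n x
      have h2 : incl n ((A - B) n (proj n x))
          = incl n (A n (proj n x)) - incl n (B n (proj n x)) := by
        rw [← map_sub]; rfl
      rw [h2, ← dist_eq_norm] at h1
      refine h1.trans_lt ?_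
      have h3 : ‖A - B‖ * ‖x‖ ≤ ‖A - B‖ * (‖x‖ + 1) := by gcongr; linarith
      have h4 : ‖A - B‖ * (‖x‖ + 1) < ε / (3 * (‖x‖ + 1)) * (‖x‖ + 1) := by gcongr
      have h5 : ε / (3 * (‖x‖ + 1)) * (‖x‖ + 1) = ε / 3 := by field_simp
      linarith
    refine ⟨N, fun m hm n hn => ?_⟩
    have h1 := hN m hm n hn
    have h2 := key m
    have h3 := key n
    rw [dist_comm] at h3
    have h4 := dist_triangle4 (incl m (A m (proj m x))) (incl m (B m (proj m x)))
      (incl n (B n (proj n x))) (incl n (A n (proj n x)))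
    linarith
  choose f hf using fun x => cauchySeq_tendsto_of_complete (hc x)
  exact ⟨continuousLinearMapOfTendsto (fun n : ℕ+ => incl n ∘L A n ∘L proj n)
    (tendsto_pi_nhds.2 hf), hf⟩

instance isClosed_seqAlg : IsClosed (seqAlg : Set BddSeq) := by
  have hP : IsClosed {A : BddSeq | ∃ W, StrongLim A.entry W} := by
    refine isClosed_of_closure_subset fun A hA => exists_strongLim_of_approx A fun ε hε => ?_
    obtain ⟨B, hB, h⟩ := Metric.mem_closure_iff.1 hA ε hε
    exact ⟨B, hB, by rwa [← dist_eq_norm]⟩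
  exact hP.inter (hP.preimage continuous_star)

/-- `𝓕` is a `C*`-algebra. -/
instance : CStarAlgebra seqAlg := StarSubalgebra.cstarAlgebra seqAlg

/-- The ideal `𝓖` of `𝓕` of all sequences `(G_n)` with `‖G_n‖ → 0`. -/
def zeroIdeal : Ideal seqAlg where
  carrier := {G | Tendsto (fun n : ℕ+ => ‖G.1 n‖) atTop (𝓝 0)}
  add_mem' := by
    intro A B hA hB
    have h := Tendsto.add hA hB
    rw [add_zero] at h
    exact squeeze_zero (fun _ => norm_nonneg _) (fun n => norm_add_le (A.1 n) (B.1 n)) h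
  zero_mem' := by
    refine tendsto_const_nhds.congr fun n => ?_
    exact (norm_zero (E := Op n)).symm
  smul_mem' := by
    intro A B hB
    have h := Tendsto.const_mul ‖A.1‖ hB
    rw [mul_zero] at h
    exact squeeze_zero (fun _ => norm_nonneg _) (fun n => (norm_mul_le (A.1 n) (B.1 n)).trans
      (mul_le_mul_of_nonneg_right (A.1.norm_apply_le n) (norm_nonneg _))) h

instance : zeroIdeal.IsTwoSided where
  mul_mem_of_left := by
    intro B A hB
    have h := Tendsto.mul_const ‖A.1‖ hB
    rw [zero_mul] at h
    exact squeeze_zero (fun _ => norm_nonneg _) (fun n => (norm_mul_le (B.1 n) (A.1 n)).trans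
      (mul_le_mul_of_nonneg_left (A.1.norm_apply_le n) (norm_nonneg _))) h

/-- The stability spectrum of a sequence `A` in `𝓕`: the spectrum of the coset `A + 𝓖` in the
quotient algebra `𝓕 / 𝓖`. -/
def stabilitySpectrum (A : seqAlg) : Set ℂ :=
  spectrum ℂ (Ideal.Quotient.mk zeroIdeal A)

/-- The absolute value `(A^* A)^{1/2}` in the `C*`-algebra `𝓕`, by continuous functional calculus
applied to the nonnegative element `A^* A`. -/
def absVal (A : seqAlg) : seqAlg := cfc Real.sqrt (star A * A)

theorem norm_finSection_le (A : L2N →L[ℂ] L2N) (n : ℕ+) : ‖finSection A n‖ ≤ ‖A‖ := by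
  refine ContinuousLinearMap.opNorm_le_bound _ (norm_nonneg _) fun x => ?_
  have h1 := (incl n).le_of_opNorm_le (norm_incl_le n) x
  have h2 := A.le_opNorm (incl n x)
  have h3 := (proj n).le_of_opNorm_le (norm_proj_le n) (A (incl n x))
  rw [one_mul] at h1 h3
  exact h3.trans (h2.trans (mul_le_mul_of_nonneg_left h1 (norm_nonneg _)))

theorem strongLim_finSection (A : L2N →L[ℂ] L2N) : StrongLim (finSection A) A := by
  intro x
  have h1 := tendsto_incl_proj (A x)
  have h2 : Tendsto (fun n : ℕ+ => incl n (proj n (A (incl n (proj n x) - x)))) atTop (𝓝 0) := by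
    have h3 : Tendsto (fun n : ℕ+ => ‖A‖ * ‖incl n (proj n x) - x‖) atTop (𝓝 0) := by
      simpa using (tendsto_iff_norm_sub_tendsto_zero.1 (tendsto_incl_proj x)).const_mul ‖A‖
    refine squeeze_zero_norm (fun n => ?_) h3
    have h4 := (incl n).le_of_opNorm_le (norm_incl_le n) (proj n (A (incl n (proj n x) - x)))
    have h5 := (proj n).le_of_opNorm_le (norm_proj_le n) (A (incl n (proj n x) - x))
    have h6 := A.le_opNorm (incl n (proj n x) - x)
    rw [one_mul] at h4 h5
    exact h4.trans (h5.trans h6)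
  have h4 := h2.add h1
  rw [zero_add] at h4
  refine h4.congr fun n => ?_
  rw [map_sub, map_sub, map_sub, sub_add_cancel]
  rfl

theorem star_finSection (A : L2N →L[ℂ] L2N) (n : ℕ+) :
    star (finSection A n) = finSection (star A) n := by
  simp only [finSection, incl, ContinuousLinearMap.star_eq_adjoint,
    ContinuousLinearMap.adjoint_comp, ContinuousLinearMap.adjoint_adjoint]
  rfl

theorem finSection_mem (A : L2N →L[ℂ] L2N) :
    ∃ h : Memℓp (finSection A) ∞, (show BddSeq from ⟨finSection A, h⟩) ∈ seqAlg := by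
  refine ⟨memℓp_infty ⟨‖A‖, ?_⟩, ⟨A, strongLim_finSection A⟩, star A, ?_⟩
  · rintro _ ⟨n, rfl⟩
    exact norm_finSection_le A n
  · have h := strongLim_finSection (star A)
    have h' : finSection (star A) = fun n => star (finSection A n) :=
      funext fun n => (star_finSection A n).symm
    rw [h'] at h
    exact h

/-- The sequence `(P_n A P_n)` of the finite sections of `A`, as an element of `𝓕`. -/
def finSections (A : L2N →L[ℂ] L2N) : seqAlg :=
  ⟨⟨finSection A, (finSection_mem A).choose⟩, (finSection_mem A).choose_spec⟩

end

end FiniteSections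

/-!
The sum `∑ g(σ_j(A_n))` is compared with a trace by the method of moments.

Write `T_n(b)` for the `n`th finite section of `T(b)`, that is, the compression of the Laurent
operator `L(b)` to the window `{0, …, n-1}`. Since `L(ab) = L(a) L(b)`, the defect
`T_n(ab) - T_n(a) T_n(b)` only sees the part of `L(b)` that maps the window out of itself. Its
squared Hilbert–Schmidt norm is at most `‖L(a)‖²` times a sum over `j < n` of tails of the square
summable series `∑ |b_k|²`, taken at the distance of `j` to the boundary of the window; as the tails
tend to zero, their Cesàro means do so too (`tendsto_hsSq_finSection_mul`). Hence
`(A_n^* A_n)^k` and `T_n(|a|^{2k})` agree up to `o(n)` in squared Hilbert–Schmidt norm, so their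
normalized traces have the same limit. As `T_n(b)` has the constant diagonal `b_0`, this limit is
`∫ |a|^{2k}` with respect to Haar measure (`tendsto_moments`), and the Weierstrass theorem extends
the convergence from even polynomials to all continuous test functions (`tendsto_average`).

It remains to localize. If a real `x` is not in the stability spectrum of `(A^* A)^{1/2}`, then a
left inverse modulo null sequences keeps the singular values of `A_n` away from `x` for large `n`
(`eventually_le_abs_sub_of_notMem_stabilitySpectrum`). By compactness they eventually lie in a
closed subset `V` of the neighborhood on which `g` is continuous. Testing with the distance to `V` shows
that `|a| ∈ V` almost everywhere, so `g` may be replaced by a continuous extension of its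
restriction to `V`.
-/

namespace FiniteSections

noncomputable section

/-! ### Laurent operators as a representation of the algebra of symbols -/

theorem mulOp_coeFn (a : LInfty) (f : LTwo) :
    (mulOp a f : AddCircle (2 * π) → ℂ) =ᵐ[AddCircle.haarAddCircle] fun t => a t * f t :=
  ContinuousLinearMap.coeFn_holder (ContinuousLinearMap.mul ℂ ℂ) a f

/-- The pointwise product of two symbols in `L^∞(𝕋)`. -/
def mulSymbol (a b : LInfty) : LInfty :=
  (ContinuousLinearMap.mul ℂ ℂ).holder ∞ a b

theorem mulSymbol_coeFn (a b : LInfty) :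
    (mulSymbol a b : AddCircle (2 * π) → ℂ) =ᵐ[AddCircle.haarAddCircle] fun t => a t * b t :=
  ContinuousLinearMap.coeFn_holder (ContinuousLinearMap.mul ℂ ℂ) a b

/-- The constant symbol `1`. -/
def oneSymbol : LInfty := Lp.const ∞ AddCircle.haarAddCircle (1 : ℂ)

theorem oneSymbol_coeFn :
    (oneSymbol : AddCircle (2 * π) → ℂ) =ᵐ[AddCircle.haarAddCircle] fun _ => 1 :=
  Lp.coeFn_const ..

theorem mulOp_mulSymbol (a b : LInfty) : mulOp (mulSymbol a b) = mulOp a ∘L mulOp b := by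
  ext1 f
  refine Lp.ext ?_
  filter_upwards [mulOp_coeFn (mulSymbol a b) f, mulSymbol_coeFn a b, mulOp_coeFn b f,
    mulOp_coeFn a (mulOp b f)] with t h1 h2 h3 h4
  rw [h1, h2, ContinuousLinearMap.comp_apply, h4, h3, mul_assoc]

theorem mulOp_oneSymbol : mulOp oneSymbol = ContinuousLinearMap.id ℂ LTwo := by
  ext1 f
  refine Lp.ext ?_
  filter_upwards [mulOp_coeFn oneSymbol f, oneSymbol_coeFn] with t h1 h2
  rw [h1, h2, one_mul, ContinuousLinearMap.id_apply]

theorem mulOp_star (a : LInfty) : mulOp (star a) = (mulOp a).adjoint := by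
  rw [ContinuousLinearMap.eq_adjoint_iff]
  intro f g
  rw [L2.inner_def, L2.inner_def]
  refine integral_congr_ae ?_
  filter_upwards [mulOp_coeFn (star a) f, mulOp_coeFn a g, Lp.coeFn_star a] with t h1 h2 h3
  rw [h1, h2, h3]
  simp only [RCLike.inner_apply, Pi.star_apply, map_mul, RCLike.star_def,
    RingHomCompTriple.comp_apply,
    RingHom.id_apply]
  ring

theorem laurent_apply (a : LInfty) (x : L2Z) :
    laurent a x = fourierBasis.repr (mulOp a (fourierBasis.repr.symm x)) := rfl

theorem laurent_mulSymbol (a b : LInfty) :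
    laurent (mulSymbol a b) = laurent a ∘L laurent b := by
  ext1 x
  simp only [laurent_apply, ContinuousLinearMap.comp_apply, mulOp_mulSymbol,
    LinearIsometryEquiv.symm_apply_apply]

theorem laurent_oneSymbol : laurent oneSymbol = ContinuousLinearMap.id ℂ L2Z := by
  ext1 x
  simp only [laurent_apply, mulOp_oneSymbol, ContinuousLinearMap.id_apply,
    LinearIsometryEquiv.apply_symm_apply]

theorem laurent_star (a : LInfty) : laurent (star a) = (laurent a).adjoint := by
  rw [ContinuousLinearMap.eq_adjoint_iff]
  intro x y
  rw [laurent_apply, laurent_apply,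
    ← LinearIsometryEquiv.inner_map_map (fourierBasis (T := 2 * π)).repr.symm,
    LinearIsometryEquiv.symm_apply_apply, mulOp_star, ContinuousLinearMap.adjoint_inner_left,
    ← LinearIsometryEquiv.inner_map_map (fourierBasis (T := 2 * π)).repr,
    LinearIsometryEquiv.apply_symm_apply]

/-- The symbol `|a|^{2k}`, built by multiplication so that its Laurent operator factors. -/
def absPow (a : LInfty) : ℕ → LInfty
  | 0 => oneSymbol
  | k + 1 => mulSymbol (star a) (mulSymbol a (absPow a k))

theorem absPow_coeFn (a : LInfty) (k : ℕ) :
    (absPow a k : AddCircle (2 * π) → ℂ) =ᵐ[AddCircle.haarAddCircle]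
      fun t => (((‖a t‖ ^ 2) ^ k : ℝ) : ℂ) := by
  induction k with
  | zero => simpa [absPow] using oneSymbol_coeFn
  | succ k ih =>
    filter_upwards [mulSymbol_coeFn (star a) (mulSymbol a (absPow a k)),
      mulSymbol_coeFn a (absPow a k), Lp.coeFn_star a, ih] with t h1 h2 h3 h4
    rw [absPow, h1, h2, h3, h4, Pi.star_apply, ← mul_assoc, RCLike.star_def, Complex.conj_mul']
    push_cast
    ring

theorem ae_norm_le_norm (a : LInfty) :
    ∀ᵐ t ∂(AddCircle.haarAddCircle : Measure (AddCircle (2 * π))), ‖a t‖ ≤ ‖a‖ := by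
  filter_upwards [ae_le_eLpNormEssSup (f := a) (μ := AddCircle.haarAddCircle)] with t ht
  rw [Lp.norm_def, eLpNorm_exponent_top, ← toReal_enorm]
  refine ENNReal.toReal_mono ?_ ht
  rw [← eLpNorm_exponent_top]
  exact Lp.eLpNorm_ne_top a

/-! ### Finite sections of Laurent operators -/

/-- The restriction `ℓ²(ℤ) → im P_n`, `x ↦ (x_0, …, x_{n-1})`. -/
def window (n : ℕ+) : L2Z →L[ℂ] Im n := proj n ∘L restrict

theorem window_apply (n : ℕ+) (x : L2Z) (i : Fin (n : ℕ)) : window n x i = x ((i : ℕ) : ℤ) := rfl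

theorem finSection_toeplitz (b : LInfty) (n : ℕ+) :
    finSection (toeplitz b) n = window n ∘L laurent b ∘L (window n).adjoint := by
  rw [window, ContinuousLinearMap.adjoint_comp]
  rfl

theorem norm_restrict_le : ‖restrict‖ ≤ 1 := LinearMap.mkContinuous_norm_le _ zero_le_one _

theorem norm_window_le (n : ℕ+) : ‖window n‖ ≤ 1 :=
  (ContinuousLinearMap.opNorm_comp_le _ _).trans
    (mul_le_one₀ (norm_proj_le n) (norm_nonneg _) norm_restrict_le)

theorem window_adjoint_single (n : ℕ+) (i : Fin (n : ℕ)) :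
    (window n).adjoint (EuclideanSpace.single i 1) = lp.single 2 ((i : ℕ) : ℤ) (1 : ℂ) := by
  classical
  refine ext_inner_right ℂ fun y => ?_
  rw [ContinuousLinearMap.adjoint_inner_left, lp.inner_single_left,
    EuclideanSpace.inner_single_left, window_apply]
  simp

theorem window_adjoint_apply (n : ℕ+) (x : Im n) (k : ℤ) :
    (window n).adjoint x k = inner ℂ (window n (lp.single 2 k (1 : ℂ))) x := by
  classical
  rw [← ContinuousLinearMap.adjoint_inner_right, lp.inner_single_left]
  simp

theorem window_adjoint_window_apply_of_mem (n : ℕ+) (y : L2Z) {k : ℕ} (hk : k < n) :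
    (window n).adjoint (window n y) (k : ℤ) = y k := by
  classical
  have h : window n (lp.single 2 (k : ℤ) (1 : ℂ))
      = EuclideanSpace.single (⟨k, hk⟩ : Fin (n : ℕ)) 1 := by
    ext i
    rw [window_apply, lp.single_apply, PiLp.single_apply]
    by_cases h : i = ⟨k, hk⟩
    · subst h; simp
    · have : ((i : ℕ) : ℤ) ≠ (k : ℤ) := fun h' => h (Fin.ext (by exact_mod_cast h'))
      simp [h, Pi.single_eq_of_ne this]
  rw [window_adjoint_apply, h, EuclideanSpace.inner_single_left, window_apply]
  simp

theorem window_adjoint_apply_of_notMem (n : ℕ+) (x : Im n) {k : ℤ} (hk : k < 0 ∨ (n : ℤ) ≤ k) :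
    (window n).adjoint x k = 0 := by
  classical
  have h : window n (lp.single 2 k (1 : ℂ)) = 0 := by
    ext i
    rw [window_apply, lp.single_apply]
    have hi := i.2
    have : ((i : ℕ) : ℤ) ≠ k := by omega
    simp [Pi.single_eq_of_ne this]
  rw [window_adjoint_apply, h, inner_zero_left]

/-! ### Decay of the Fourier coefficients off the diagonal -/

/-- The tail `∑_{|k| ≥ m} |b_k|²` of the Fourier coefficients of `b`. -/
def fourierTail (b : LInfty) (m : ℕ) : ℝ :=
  ∑' k : ℤ, if m ≤ k.natAbs then ‖fourierCoeff (b : AddCircle (2 * π) → ℂ) k‖ ^ 2 else 0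

theorem summable_norm_sq (x : L2Z) : Summable fun k => ‖x k‖ ^ 2 := by
  have h := (memℓp_gen_iff (p := 2) (by norm_num)).1 (lp.memℓp x)
  simpa only [ENNReal.toReal_ofNat, Real.rpow_ofNat] using h

theorem norm_sq_eq_tsum (x : L2Z) : ‖x‖ ^ 2 = ∑' k, ‖x k‖ ^ 2 := by
  have h := lp.norm_rpow_eq_tsum (p := 2) (by norm_num) x
  simpa only [ENNReal.toReal_ofNat, Real.rpow_ofNat] using h

theorem summable_fourierCoeff_sq (b : LInfty) :
    Summable fun k : ℤ => ‖fourierCoeff (b : AddCircle (2 * π) → ℂ) k‖ ^ 2 := by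
  refine (summable_norm_sq (laurent b (lp.single 2 0 1))).congr fun k => ?_
  rw [laurent_single_apply, sub_zero]

theorem summable_fourierTail (b : LInfty) (m : ℕ) : Summable fun k : ℤ =>
    if m ≤ k.natAbs then ‖fourierCoeff (b : AddCircle (2 * π) → ℂ) k‖ ^ 2 else 0 :=
  (summable_fourierCoeff_sq b).of_nonneg_of_le (fun k => by split_ifs <;> positivity)
    fun k => by split_ifs <;> [exact le_rfl; positivity]

theorem tendsto_fourierTail (b : LInfty) : Tendsto (fourierTail b) atTop (𝓝 0) := by
  rw [← tsum_zero (α := ℝ) (β := ℤ)]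
  refine tendsto_tsum_of_dominated_convergence (summable_fourierCoeff_sq b) (fun k => ?_)
    (Eventually.of_forall fun m k => ?_)
  · refine tendsto_const_nhds.congr' ?_
    filter_upwards [eventually_gt_atTop k.natAbs] with m hm
    rw [if_neg (not_le.2 hm)]
  · split_ifs
    · simp
    · simp

/-- The part of the `j`th column of `L(b)` outside the window `{0, …, n-1}`: an index outside the
window is at distance at least `n - j` from `j` on the right and `j + 1` on the left. -/
theorem norm_sq_sub_window_laurent_single_le (b : LInfty) (n : ℕ+) (j : Fin (n : ℕ)) :
    ‖laurent b (lp.single 2 ((j : ℕ) : ℤ) 1)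
        - (window n).adjoint (window n (laurent b (lp.single 2 ((j : ℕ) : ℤ) 1)))‖ ^ 2
      ≤ fourierTail b (n - 1 - j + 1) + fourierTail b (j + 1) := by
  -- `n - j` is written `n - 1 - j + 1` to match `Finset.sum_range_reflect`.
  set y := laurent b (lp.single 2 ((j : ℕ) : ℤ) 1) with hy
  have h1 : ∀ m, HasSum (fun k : ℤ => if m ≤ (k - (j : ℕ)).natAbs then ‖y k‖ ^ 2 else 0)
      (fourierTail b m) := by
    intro m
    have := (Equiv.subRight ((j : ℕ) : ℤ)).hasSum_iff.2 (summable_fourierTail b m).hasSum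
    refine this.congr_fun ?_
    intro k
    simp only [hy, laurent_single_apply, Function.comp_apply, Equiv.subRight_apply]
  rw [norm_sq_eq_tsum, ← ((h1 (n - 1 - j + 1)).add (h1 (j + 1))).tsum_eq]
  refine (summable_norm_sq _).tsum_le_tsum (fun k => ?_)
    ((h1 (n - 1 - j + 1)).add (h1 (j + 1))).summable
  rw [lp.coeFn_sub, Pi.sub_apply]
  have hj := j.2
  by_cases hk : k < 0 ∨ (n : ℤ) ≤ k
  · rw [window_adjoint_apply_of_notMem n _ hk, sub_zero]
    rcases hk with hk | hk
    · rw [if_pos (show (j : ℕ) + 1 ≤ (k - (j : ℕ)).natAbs by omega)]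
      split_ifs <;> simp
    · rw [if_pos (show (n : ℕ) - 1 - j + 1 ≤ (k - (j : ℕ)).natAbs by omega)]
      split_ifs <;> simp
  · push Not at hk
    lift k to ℕ using hk.1
    rw [window_adjoint_window_apply_of_mem n y (by exact_mod_cast hk.2), sub_self]
    simp only [norm_zero]
    have : ∀ (p : Prop) [Decidable p], (0 : ℝ) ≤ if p then ‖y k‖ ^ 2 else 0 := fun p _ => by
      split_ifs <;> positivity
    have := add_nonneg (this ((n : ℕ) - 1 - j + 1 ≤ ((k : ℤ) - (j : ℕ)).natAbs))
      (this ((j : ℕ) + 1 ≤ ((k : ℤ) - (j : ℕ)).natAbs))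
    simpa using this

/-! ### Asymptotic equivalence in the normalized Hilbert–Schmidt norm -/

/-- The square of the Hilbert–Schmidt norm on `L(im P_n)`. -/
def hsSq {n : ℕ+} (D : Op n) : ℝ := ∑ i : Fin (n : ℕ), ‖D (EuclideanSpace.single i 1)‖ ^ 2

theorem hsSq_nonneg {n : ℕ+} (D : Op n) : 0 ≤ hsSq D :=
  Finset.sum_nonneg fun _ _ => by positivity

theorem hsSq_mul_le {n : ℕ+} (C D : Op n) : hsSq (C * D) ≤ ‖C‖ ^ 2 * hsSq D := by
  rw [hsSq, hsSq, Finset.mul_sum]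
  refine Finset.sum_le_sum fun i _ => ?_
  rw [← mul_pow]
  gcongr
  exact C.le_opNorm _

theorem hsSq_add_le {n : ℕ+} (C D : Op n) : hsSq (C + D) ≤ 2 * hsSq C + 2 * hsSq D := by
  rw [hsSq, hsSq, hsSq, Finset.mul_sum, Finset.mul_sum, ← Finset.sum_add_distrib]
  refine Finset.sum_le_sum fun i _ => ?_
  have h := norm_add_le (C (EuclideanSpace.single i 1)) (D (EuclideanSpace.single i 1))
  rw [add_apply]
  nlinarith [sq_nonneg (‖C (EuclideanSpace.single i 1)‖ - ‖D (EuclideanSpace.single i 1)‖),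
    norm_nonneg (C (EuclideanSpace.single i 1) + D (EuclideanSpace.single i 1))]

/-- The normalized trace is dominated by the normalized Hilbert–Schmidt norm. -/
theorem norm_trace_div_sq_le {n : ℕ+} (D : Op n) :
    ‖D.toLinearMap.trace ℂ (Im n) / (n : ℂ)‖ ^ 2 ≤ hsSq D / n := by
  have h1 : ‖D.toLinearMap.trace ℂ (Im n)‖
      ≤ ∑ i : Fin (n : ℕ), ‖D (EuclideanSpace.single i 1)‖ := by
    rw [LinearMap.trace_eq_sum_inner _ (EuclideanSpace.basisFun (Fin (n : ℕ)) ℂ)]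
    refine (norm_sum_le _ _).trans (Finset.sum_le_sum fun i _ => ?_)
    rw [EuclideanSpace.basisFun_apply]
    refine (norm_inner_le_norm _ _).trans ?_
    simp
  have h2 := sq_sum_le_card_mul_sum_sq (s := Finset.univ)
    (f := fun i : Fin (n : ℕ) => ‖D (EuclideanSpace.single i 1)‖)
  rw [Finset.card_univ, Fintype.card_fin] at h2
  have hn : (0 : ℝ) < (n : ℕ) := by exact_mod_cast n.pos
  have h3 := (pow_le_pow_left₀ (norm_nonneg _) h1 2).trans h2
  rw [norm_div, Complex.norm_natCast, div_pow, div_le_div_iff₀ (by positivity) hn, hsSq]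
  nlinarith

theorem norm_finSection_toeplitz_le (b : LInfty) (n : ℕ+) :
    ‖finSection (toeplitz b) n‖ ≤ ‖toeplitz b‖ := norm_finSection_le _ n

theorem hsSq_finSection_mul_le (a b : LInfty) (n : ℕ+) :
    hsSq (finSection (toeplitz (mulSymbol a b)) n
        - finSection (toeplitz a) n * finSection (toeplitz b) n)
      ≤ ‖laurent a‖ ^ 2 * (2 * ∑ j ∈ Finset.range n, fourierTail b (j + 1)) := by
  have h1 : ∑ j : Fin (n : ℕ), (fourierTail b (n - 1 - j + 1) + fourierTail b (j + 1))
      = 2 * ∑ j ∈ Finset.range n, fourierTail b (j + 1) := by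
    rw [Fin.sum_univ_eq_sum_range (fun j => fourierTail b (n - 1 - j + 1) + fourierTail b (j + 1)),
      Finset.sum_add_distrib, Finset.sum_range_reflect (fun j => fourierTail b (j + 1)), two_mul]
  rw [← h1, hsSq, Finset.mul_sum]
  refine Finset.sum_le_sum fun j _ => ?_
  refine le_trans ?_ (mul_le_mul_of_nonneg_left
    (norm_sq_sub_window_laurent_single_le b n j) (sq_nonneg _))
  rw [← mul_pow]
  gcongr
  rw [sub_apply, mul_apply_eq_comp]
  simp only [finSection_toeplitz, laurent_mulSymbol, ContinuousLinearMap.comp_apply,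
    window_adjoint_single]
  rw [← map_sub, ← map_sub]
  refine ((window n).le_of_opNorm_le (norm_window_le n) _).trans ?_
  rw [one_mul]
  exact (laurent a).le_opNorm _

/-- Compression to `im P_n` is asymptotically multiplicative in the normalized
Hilbert–Schmidt norm. -/
theorem tendsto_hsSq_finSection_mul (a b : LInfty) :
    Tendsto (fun n : ℕ+ => hsSq (finSection (toeplitz (mulSymbol a b)) n
      - finSection (toeplitz a) n * finSection (toeplitz b) n) / n) atTop (𝓝 0) := by
  have h1 := ((tendsto_add_atTop_iff_nat 1).2 (tendsto_fourierTail b)).cesaro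
  have h2 := (h1.comp tendsto_PNat_val_atTop_atTop).const_mul (‖laurent a‖ ^ 2 * 2)
  rw [mul_zero] at h2
  refine squeeze_zero (fun n => div_nonneg (hsSq_nonneg _) (Nat.cast_nonneg _)) (fun n => ?_) h2
  refine (div_le_div_of_nonneg_right (hsSq_finSection_mul_le a b n)
    (Nat.cast_nonneg _)).trans_eq ?_
  rw [Function.comp_apply]
  ring

theorem finSection_toeplitz_star (a : LInfty) (n : ℕ+) :
    finSection (toeplitz (star a)) n = star (finSection (toeplitz a) n) := by
  rw [finSection_toeplitz, finSection_toeplitz, laurent_star, ContinuousLinearMap.star_eq_adjoint,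
    ContinuousLinearMap.adjoint_comp, ContinuousLinearMap.adjoint_comp,
    ContinuousLinearMap.adjoint_adjoint]
  rfl

theorem finSection_toeplitz_one (n : ℕ+) : finSection (toeplitz oneSymbol) n = 1 := by
  rw [finSection, toeplitz, laurent_oneSymbol]
  ext x i
  rw [one_apply_eq_self]
  have h : ∀ y : L2N, restrict (restrict.adjoint y) = y := by
    classical
    intro y
    ext k
    have h1 : restrict (lp.single 2 (k : ℤ) (1 : ℂ)) = lp.single 2 k (1 : ℂ) := by
      ext i
      rw [restrict_apply, lp.single_apply, lp.single_apply]
      by_cases h : i = k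
      · subst h; simp
      · rw [Pi.single_eq_of_ne h, Pi.single_eq_of_ne (by exact_mod_cast h)]
    have h2 : restrict.adjoint y (k : ℤ)
        = inner ℂ (lp.single 2 (k : ℤ) (1 : ℂ) : L2Z) (restrict.adjoint y) := by
      rw [lp.inner_single_left]; simp
    rw [restrict_apply, h2, ContinuousLinearMap.adjoint_inner_right, h1, lp.inner_single_left]
    simp
  simp only [ContinuousLinearMap.comp_apply, ContinuousLinearMap.id_apply, h, proj_incl]

/-- If `E_n` is equivalent to `C_n D_n` with `C_n` bounded, then `D_n` may be replaced by any
equivalent `F_n`. -/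
theorem tendsto_hsSq_mul_left {C D E : ∀ n : ℕ+, Op n} {M : ℝ} (hC : ∀ n, ‖C n‖ ≤ M)
    (h1 : Tendsto (fun n => hsSq (E n - C n * D n) / n) atTop (𝓝 0)) {F : ∀ n : ℕ+, Op n}
    (h2 : Tendsto (fun n => hsSq (D n - F n) / n) atTop (𝓝 0)) :
    Tendsto (fun n => hsSq (E n - C n * F n) / n) atTop (𝓝 0) := by
  have h3 := (h1.const_mul 2).add (h2.const_mul (2 * M ^ 2))
  rw [mul_zero, mul_zero, zero_add] at h3
  refine squeeze_zero (fun n => div_nonneg (hsSq_nonneg _) (Nat.cast_nonneg _)) (fun n => ?_) h3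
  have h4 : E n - C n * F n = (E n - C n * D n) + C n * (D n - F n) := by noncomm_ring
  have h5 := hsSq_add_le (E n - C n * D n) (C n * (D n - F n))
  have h6 := (hsSq_mul_le (C n) (D n - F n)).trans (mul_le_mul_of_nonneg_right
    (pow_le_pow_left₀ (norm_nonneg _) (hC n) 2) (hsSq_nonneg _))
  rw [h4]
  calc _ ≤ (2 * hsSq (E n - C n * D n) + 2 * (M ^ 2 * hsSq (D n - F n))) / (n : ℝ) := by
        gcongr; linarith
    _ = _ := by ring

theorem tendsto_hsSq_absPow (a : LInfty) (k : ℕ) :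
    Tendsto (fun n : ℕ+ => hsSq (finSection (toeplitz (absPow a k)) n
      - (star (finSection (toeplitz a) n) * finSection (toeplitz a) n) ^ k) / n) atTop (𝓝 0) := by
  induction k with
  | zero => simp [absPow, finSection_toeplitz_one, hsSq]
  | succ k ih =>
    have h1 := tendsto_hsSq_mul_left (norm_finSection_toeplitz_le a)
      (tendsto_hsSq_finSection_mul a (absPow a k)) ih
    have h2 := tendsto_hsSq_mul_left (norm_finSection_toeplitz_le (star a))
      (tendsto_hsSq_finSection_mul (star a) (mulSymbol a (absPow a k))) h1
    refine h2.congr fun n => ?_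
    rw [absPow, finSection_toeplitz_star, pow_succ', mul_assoc]

theorem trace_finSection_toeplitz (b : LInfty) (n : ℕ+) :
    (finSection (toeplitz b) n).toLinearMap.trace ℂ (Im n)
      = n * fourierCoeff (b : AddCircle (2 * π) → ℂ) 0 := by
  rw [LinearMap.trace_eq_sum_inner _ (EuclideanSpace.basisFun (Fin (n : ℕ)) ℂ)]
  have h : ∀ i : Fin (n : ℕ), inner ℂ (EuclideanSpace.basisFun (Fin (n : ℕ)) ℂ i)
      ((finSection (toeplitz b) n).toLinearMap (EuclideanSpace.basisFun (Fin (n : ℕ)) ℂ i))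
      = fourierCoeff (b : AddCircle (2 * π) → ℂ) 0 := by
    intro i
    rw [EuclideanSpace.basisFun_apply, ContinuousLinearMap.coe_coe, finSection_toeplitz,
      ContinuousLinearMap.comp_apply, ContinuousLinearMap.comp_apply, window_adjoint_single,
      EuclideanSpace.inner_single_left, window_apply, laurent_single_apply, sub_self]
    simp
  rw [Finset.sum_congr rfl fun i _ => h i]
  simp

theorem tendsto_trace_pow (a : LInfty) (k : ℕ) :
    Tendsto (fun n : ℕ+ => ((star (finSection (toeplitz a) n) * finSection (toeplitz a) n)
      ^ k).toLinearMap.trace ℂ (Im n) / (n : ℂ)) atTop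
      (𝓝 (fourierCoeff (absPow a k : AddCircle (2 * π) → ℂ) 0)) := by
  rw [tendsto_iff_norm_sub_tendsto_zero]
  have h1 := (tendsto_hsSq_absPow a k).sqrt
  rw [Real.sqrt_zero] at h1
  refine squeeze_zero (fun _ => norm_nonneg _) (fun n => Real.le_sqrt_of_sq_le ?_) h1
  refine le_trans (le_of_eq ?_) (norm_trace_div_sq_le _)
  have hn : ((n : ℕ) : ℂ) ≠ 0 := by exact_mod_cast n.ne_zero
  rw [ContinuousLinearMap.toLinearMap_sub, map_sub, trace_finSection_toeplitz, norm_sub_rev,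
    sub_div,
    mul_div_cancel_left₀ _ hn]

/-! ### Moments of the singular values -/

/-- The power sums of the squared singular values are traces, by evaluation in an eigenbasis of
`A^* A`. -/
theorem sum_singularValues_pow {n : ℕ+} (A : Op n) (k : ℕ) :
    ∑ j ∈ Finset.range n, (((A.toLinearMap.singularValues j ^ 2) ^ k : ℝ) : ℂ)
      = ((star A * A) ^ k).toLinearMap.trace ℂ (Im n) := by
  have hn : Module.finrank ℂ (Im n) = n := finrank_euclideanSpace_fin
  have hS := A.toLinearMap.isSymmetric_adjoint_comp_self
  rw [LinearMap.trace_eq_sum_inner _ (hS.eigenvectorBasis hn),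
    ← Fin.sum_univ_eq_sum_range
      (fun j => (((A.toLinearMap.singularValues j ^ 2) ^ k : ℝ) : ℂ))]
  refine Finset.sum_congr rfl fun i _ => ?_
  rw [A.toLinearMap.sq_singularValues_fin hn i]
  have h1 : ∀ k : ℕ, ((star A * A) ^ k) (hS.eigenvectorBasis hn i)
      = ((hS.eigenvalues hn i : ℂ) ^ k) • hS.eigenvectorBasis hn i := by
    intro k
    induction k with
    | zero => simp
    | succ k ih =>
      have h2 : (star A * A) (hS.eigenvectorBasis hn i)
          = (hS.eigenvalues hn i : ℂ) • hS.eigenvectorBasis hn i :=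
        hS.apply_eigenvectorBasis hn i
      rw [pow_succ', mul_apply_eq_comp, ih, map_smul, h2, smul_smul, pow_succ]
  rw [ContinuousLinearMap.coe_coe, h1, inner_smul_right, inner_self_eq_norm_sq_to_K,
    (hS.eigenvectorBasis hn).norm_eq_one]
  simp

theorem fourierCoeff_absPow_zero (a : LInfty) (k : ℕ) :
    fourierCoeff (absPow a k : AddCircle (2 * π) → ℂ) 0
      = ((∫ t, (‖a t‖ ^ 2) ^ k ∂AddCircle.haarAddCircle : ℝ) : ℂ) := by
  rw [fourierCoeff, ← integral_complex_ofReal]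
  refine integral_congr_ae ?_
  filter_upwards [absPow_coeFn a k] with t ht
  rw [ht]
  simp

theorem tendsto_moments (a : LInfty) (k : ℕ) :
    Tendsto (fun n : ℕ+ => (∑ j ∈ Finset.range n,
      ((finSection (toeplitz a) n).toLinearMap.singularValues j ^ 2) ^ k) / (n : ℝ)) atTop
      (𝓝 (∫ t, (‖a t‖ ^ 2) ^ k ∂AddCircle.haarAddCircle)) := by
  have h1 := tendsto_trace_pow a k
  rw [fourierCoeff_absPow_zero] at h1
  refine ((Complex.continuous_re.tendsto _).comp h1).congr fun n => ?_
  rw [Function.comp_apply, ← sum_singularValues_pow, ← Complex.ofReal_sum, ← Complex.ofReal_natCast,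
    ← Complex.ofReal_div, Complex.ofReal_re]

theorem exists_singularVector {n : ℕ+} (A : Op n) {j : ℕ} (hj : j < n) :
    ∃ v : Im n, ‖v‖ = 1 ∧
      (star A * A) v = ((A.toLinearMap.singularValues j : ℂ) ^ 2) • v := by
  have hn : Module.finrank ℂ (Im n) = n := finrank_euclideanSpace_fin
  have hS := A.toLinearMap.isSymmetric_adjoint_comp_self
  refine ⟨hS.eigenvectorBasis hn ⟨j, hj⟩, (hS.eigenvectorBasis hn).norm_eq_one _, ?_⟩
  rw [← Complex.ofReal_pow, A.toLinearMap.sq_singularValues_of_lt hn hj]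
  exact hS.apply_eigenvectorBasis hn ⟨j, hj⟩

theorem singularValues_le_norm {n : ℕ+} (A : Op n) {j : ℕ} (hj : j < n) :
    A.toLinearMap.singularValues j ≤ ‖A‖ := by
  obtain ⟨v, hv, h⟩ := exists_singularVector A hj
  have h1 := (star A * A).le_opNorm v
  rw [h, norm_smul, hv, mul_one, mul_one, CStarRing.norm_star_mul_self, norm_pow,
    Complex.norm_real, Real.norm_eq_abs, sq_abs, ← sq] at h1
  exact le_of_sq_le_sq h1 (norm_nonneg _)

/-! ### From moments to continuous test functions -/

theorem aestronglyMeasurable_comp_norm {E : Type*} [TopologicalSpace E]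
    [TopologicalSpace.PseudoMetrizableSpace E] (a : LInfty) {h : ℝ → E} (hc : Continuous h) :
    AEStronglyMeasurable (fun t => h ‖a t‖) AddCircle.haarAddCircle :=
  hc.comp_aestronglyMeasurable (Lp.aestronglyMeasurable a).norm

theorem integrable_comp_norm {E : Type*} [NormedAddCommGroup E] (a : LInfty) {h : ℝ → E}
    (hc : Continuous h) : Integrable (fun t => h ‖a t‖) AddCircle.haarAddCircle := by
  obtain ⟨C, hC⟩ := (isCompact_Icc (a := (0 : ℝ)) (b := ‖a‖)).exists_bound_of_continuousOn
    hc.continuousOn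
  refine Integrable.of_bound (aestronglyMeasurable_comp_norm a hc) C ?_
  filter_upwards [ae_norm_le_norm a] with t ht
  exact hC _ ⟨norm_nonneg _, ht⟩

theorem tendsto_average_polynomial (a : LInfty) (p : Polynomial ℝ) :
    Tendsto (fun n : ℕ+ => (∑ j ∈ Finset.range n,
      p.eval ((finSection (toeplitz a) n).toLinearMap.singularValues j ^ 2)) / (n : ℝ)) atTop
      (𝓝 (∫ t, p.eval (‖a t‖ ^ 2) ∂AddCircle.haarAddCircle)) := by
  induction p using Polynomial.induction_on' with
  | add p q hp hq =>
    simp only [Polynomial.eval_add]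
    rw [integral_add (integrable_comp_norm a (h := fun x => p.eval (x ^ 2)) (by fun_prop))
      (integrable_comp_norm a (h := fun x => q.eval (x ^ 2)) (by fun_prop))]
    refine (hp.add hq).congr fun n => ?_
    rw [Finset.sum_add_distrib, add_div]
  | monomial k c =>
    simp only [Polynomial.eval_monomial]
    rw [integral_const_mul]
    refine ((tendsto_moments a k).const_mul c).congr fun n => ?_
    rw [← Finset.mul_sum, mul_div_assoc]

theorem tendsto_average_real (a : LInfty) {h : ℝ → ℝ} (hc : Continuous h) :
    Tendsto (fun n : ℕ+ => (∑ j ∈ Finset.range n,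
      h ((finSection (toeplitz a) n).toLinearMap.singularValues j)) / (n : ℝ)) atTop
      (𝓝 (∫ t, h ‖a t‖ ∂AddCircle.haarAddCircle)) := by
  set M := max ‖toeplitz a‖ ‖a‖
  rw [Metric.tendsto_atTop']
  intro ε hε
  -- Odd powers are not available as moments, so `x ↦ h √x` is approximated and evaluated at `x²`.
  obtain ⟨p, hp⟩ := exists_polynomial_near_of_continuousOn 0 (M ^ 2) (fun x => h √x)
    (hc.comp Real.continuous_sqrt).continuousOn (ε / 4) (by positivity)
  have hp' : ∀ x, 0 ≤ x → x ≤ M → |h x - p.eval (x ^ 2)| ≤ ε / 4 := by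
    intro x h0 h1
    have := hp (x ^ 2) ⟨by positivity, by gcongr⟩
    rw [Real.sqrt_sq h0, abs_sub_comm] at this
    exact this.le
  obtain ⟨N, hN⟩ := Metric.tendsto_atTop'.1 (tendsto_average_polynomial a p) (ε / 4) (by positivity)
  refine ⟨N, fun n hn => ?_⟩
  have h1 := hN n hn
  have hn0 : (0 : ℝ) < (n : ℕ) := by exact_mod_cast n.pos
  have h2 : dist ((∑ j ∈ Finset.range n,
      h ((finSection (toeplitz a) n).toLinearMap.singularValues j)) / (n : ℝ))
      ((∑ j ∈ Finset.range n,
        p.eval ((finSection (toeplitz a) n).toLinearMap.singularValues j ^ 2)) / (n : ℝ))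
      ≤ ε / 4 := by
    rw [Real.dist_eq, ← sub_div, ← Finset.sum_sub_distrib, abs_div, abs_of_pos hn0,
      div_le_iff₀ hn0]
    refine (Finset.abs_sum_le_sum_abs _ _).trans ((Finset.sum_le_sum fun j hj => hp' _
      (LinearMap.singularValues_nonneg _ j) (((singularValues_le_norm _
        (Finset.mem_range.1 hj)).trans (norm_finSection_toeplitz_le a n)).trans
          (le_max_left _ _))).trans_eq ?_)
    rw [Finset.sum_const, Finset.card_range, nsmul_eq_mul, mul_comm]
  have h3 : dist (∫ t, p.eval (‖a t‖ ^ 2) ∂AddCircle.haarAddCircle)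
      (∫ t, h ‖a t‖ ∂AddCircle.haarAddCircle) ≤ ε / 4 := by
    rw [dist_comm, dist_eq_norm, ← integral_sub (integrable_comp_norm a hc)
      (integrable_comp_norm a (h := fun x => p.eval (x ^ 2)) (by fun_prop))]
    refine (norm_integral_le_of_norm_le_const (C := ε / 4) ?_).trans_eq (by simp)
    filter_upwards [ae_norm_le_norm a] with t ht
    exact hp' _ (norm_nonneg _) (ht.trans (le_max_right _ _))
  refine (dist_triangle _ _ _).trans_lt (lt_of_le_of_lt
    (add_le_add h2 ((dist_triangle _ _ _).trans (add_le_add h1.le h3))) ?_)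
  linarith

theorem tendsto_average (a : LInfty) {h : ℝ → ℂ} (hc : Continuous h) :
    Tendsto (fun n : ℕ+ => (∑ j ∈ Finset.range n,
      h ((finSection (toeplitz a) n).toLinearMap.singularValues j)) / (n : ℂ)) atTop
      (𝓝 (∫ t, h ‖a t‖ ∂AddCircle.haarAddCircle)) := by
  have h1 := tendsto_average_real a (Complex.continuous_re.comp hc)
  have h2 := tendsto_average_real a (Complex.continuous_im.comp hc)
  have h3 := ((Complex.continuous_ofReal.tendsto _).comp h1).add
    (((Complex.continuous_ofReal.tendsto _).comp h2).mul_const Complex.I)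
  have h4 := integral_re_add_im (integrable_comp_norm a hc)
  simp only [RCLike.re_to_complex, RCLike.im_to_complex, RCLike.I_to_complex,
    Complex.coe_algebraMap] at h4
  rw [← h4]
  refine h3.congr fun n => ?_
  apply Complex.ext <;> simp [← Complex.ofReal_natCast, Complex.div_ofReal_re,
    Complex.div_ofReal_im,
    Function.comp_apply]

/-! ### The stability spectrum controls the singular values -/

/-- The entries of `(A^* A)^{1/2}` are positive: it is the square of the fourth root of `A^* A`. -/
theorem exists_absVal_eq_star_mul_self (A : seqAlg) : ∃ C : seqAlg, absVal A = star C * C := by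
  refine ⟨cfc (fun t => √√t) (star A * A), ?_⟩
  have h1 : IsSelfAdjoint (cfc (fun t => √√t) (star A * A)) := cfc_predicate _ _
  rw [h1.star_eq, absVal, ← cfc_mul (fun t => √√t) (fun t => √√t) (star A * A)
    (by fun_prop) (by fun_prop)]
  exact cfc_congr fun t _ => (Real.mul_self_sqrt (Real.sqrt_nonneg t)).symm

theorem absVal_mul_self (A : seqAlg) : absVal A * absVal A = star A * A := by
  rw [absVal, ← cfc_mul Real.sqrt Real.sqrt (star A * A) (by fun_prop) (by fun_prop)]
  conv_rhs => rw [← cfc_id ℝ (star A * A)]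
  exact cfc_congr fun t ht => Real.mul_self_sqrt (spectrum_star_mul_self_nonneg t ht)

/-- Singular vectors of `A_n` are eigenvectors of the `n`th entry of `(A^* A)^{1/2}`. -/
theorem absVal_apply_eq_smul (A : seqAlg) (n : ℕ+) {σ : ℝ} (hσ : 0 ≤ σ) {v : Im n}
    (hv : (star (A.1 n) * A.1 n) v = ((σ : ℂ) ^ 2) • v) :
    (absVal A).1 n v = (σ : ℂ) • v := by
  obtain ⟨C, hC⟩ := exists_absVal_eq_star_mul_self A
  have hB : (absVal A).1 n = star (C.1 n) * C.1 n := by rw [hC]; rfl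
  have hsq : (absVal A).1 n * (absVal A).1 n = star (A.1 n) * A.1 n :=
    congrArg (fun X : seqAlg => X.1 n) (absVal_mul_self A)
  set B := (absVal A).1 n
  rw [← hsq, mul_apply_eq_comp] at hv
  -- `(B + σ) w = (B² - σ²) v = 0` and `B ≥ 0`, which forces `w = 0` when `σ > 0`.
  set w := B v - (σ : ℂ) • v with hw
  have h1 : B w = -((σ : ℂ) • w) := by
    rw [hw, map_sub, hv, map_smul, smul_sub, smul_smul, sq]
    abel
  have h2 : ∀ y z, inner ℂ y (B z) = inner ℂ (C.1 n y) (C.1 n z) := by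
    intro y z
    rw [hB, mul_apply_eq_comp, ContinuousLinearMap.star_eq_adjoint,
      ContinuousLinearMap.adjoint_inner_right]
  have h3 : ∀ y z, inner ℂ (B y) z = inner ℂ (C.1 n y) (C.1 n z) := by
    intro y z
    rw [hB, mul_apply_eq_comp, ContinuousLinearMap.star_eq_adjoint,
      ContinuousLinearMap.adjoint_inner_left]
  have h4 : ‖C.1 n w‖ ^ 2 + σ * ‖w‖ ^ 2 = 0 := by
    have h5 := h2 w w
    rw [h1, inner_neg_right, inner_smul_right, inner_self_eq_norm_sq_to_K,
      inner_self_eq_norm_sq_to_K] at h5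
    have h6 : -(σ * ‖w‖ ^ 2) = ‖C.1 n w‖ ^ 2 :=
      Complex.ofReal_injective (by simpa using h5)
    linarith
  suffices w = 0 from sub_eq_zero.1 this
  rcases hσ.eq_or_lt with h0 | h0
  · -- `σ = 0`: here `w = B v` and `B w = 0`, so `‖w‖² = ⟪v, B w⟫ = 0`.
    subst h0
    have h5 : B w = 0 := by rw [h1]; simp
    have h6 : w = B v := by rw [hw]; simp
    rw [← inner_self_eq_zero (𝕜 := ℂ)]
    nth_rw 1 [h6]
    rw [h3, ← h2, h5, inner_zero_right]
  · have h5 : ‖w‖ ^ 2 = 0 := by nlinarith [sq_nonneg ‖C.1 n w‖, sq_nonneg ‖w‖]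
    simpa using h5

/-- Outside the stability spectrum there is a `C` with `C (x - |A|) - 1` a null sequence. A unit
eigenvector of the `n`th entry of `|A|` for `σ` then gives `1 ≤ |σ - x| ‖C‖ + o(1)`. -/
theorem eventually_le_abs_sub_of_notMem_stabilitySpectrum (A : seqAlg) {x : ℝ}
    (hx : (x : ℂ) ∉ stabilitySpectrum (absVal A)) :
    ∃ δ > 0, ∀ᶠ n : ℕ+ in atTop, ∀ j < (n : ℕ),
      δ ≤ |(A.1 n).toLinearMap.singularValues j - x| := by
  rw [stabilitySpectrum, spectrum.notMem_iff] at hx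
  obtain ⟨c, hc⟩ := hx.exists_left_inv
  obtain ⟨C, rfl⟩ := Ideal.Quotient.mk_surjective c
  have h1 : C * (algebraMap ℂ seqAlg x - absVal A) - 1 ∈ zeroIdeal := by
    rw [← Ideal.Quotient.eq, map_mul, map_sub, map_one, ← hc]
    rfl
  have h2 : Tendsto (fun n : ℕ+ => ‖(C * (algebraMap ℂ seqAlg x - absVal A) - 1).1 n‖)
    atTop (𝓝 0) := h1
  refine ⟨1 / (2 * (‖C.1‖ + 1)), by positivity, ?_⟩
  filter_upwards [h2.eventually_lt_const (show (0 : ℝ) < 1 / 2 by norm_num)] with n hn j hj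
  obtain ⟨v, hv, hAv⟩ := exists_singularVector (A.1 n) hj
  set σ := (A.1 n).toLinearMap.singularValues j
  have h3 := absVal_apply_eq_smul A n (LinearMap.singularValues_nonneg _ j) hAv
  set D : Op n := (C * (algebraMap ℂ seqAlg x - absVal A) - 1).1 n with hD
  have h4 : D v = ((x : ℂ) - σ) • C.1 n v - v := by
    have : D v = C.1 n ((algebraMap ℂ (Op n) x) v - (absVal A).1 n v) - v := rfl
    rw [this, h3, Algebra.algebraMap_eq_smul_one, smul_apply,
      one_apply_eq_self, ← sub_smul, map_smul]
  have h5 : ‖C.1 n v‖ ≤ ‖C.1‖ := by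
    simpa [hv] using (C.1 n).le_of_opNorm_le (C.1.norm_apply_le n) v
  have h6 : ‖D v‖ ≤ ‖D‖ := by simpa [hv] using D.le_opNorm v
  have h7 : v = ((x : ℂ) - σ) • C.1 n v - D v := by rw [h4]; abel
  have h8 : (1 : ℝ) ≤ |σ - x| * ‖C.1‖ + ‖D‖ := by
    calc (1 : ℝ) = ‖((x : ℂ) - σ) • C.1 n v - D v‖ := by rw [← h7, hv]
      _ ≤ ‖((x : ℂ) - σ) • C.1 n v‖ + ‖D v‖ := norm_sub_le _ _
      _ = |σ - x| * ‖C.1 n v‖ + ‖D v‖ := by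
        rw [norm_smul, ← Complex.ofReal_sub, Complex.norm_real, Real.norm_eq_abs, abs_sub_comm]
      _ ≤ _ := by gcongr
  rw [div_le_iff₀ (by positivity)]
  nlinarith [abs_nonneg (σ - x), norm_nonneg C.1]

/-- If a bounded array of reals eventually stays away from every point outside `K`, then it
eventually stays in a closed subset of any given neighborhood of `K`. -/
theorem exists_isClosed_eventually_mem {s : ℕ+ → ℕ → ℝ} {M : ℝ} {K U : Set ℝ} (hU : U ∈ 𝓝ˢ K)
    (hs : ∀ n : ℕ+, ∀ j < (n : ℕ), s n j ∈ Set.Icc 0 M)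
    (hK : ∀ x ∉ K, ∃ δ > 0, ∀ᶠ n : ℕ+ in atTop, ∀ j < (n : ℕ), δ ≤ |s n j - x|) :
    ∃ V : Set ℝ, IsClosed V ∧ V ⊆ U ∧ ∀ᶠ n : ℕ+ in atTop, ∀ j < (n : ℕ), s n j ∈ V := by
  choose! δ hδ hsδ using hK
  have hKU : K ⊆ interior U := subset_interior_iff_mem_nhdsSet.2 hU
  have hcpt : IsCompact (Set.Icc 0 M \ interior U) := isCompact_Icc.diff isOpen_interior
  obtain ⟨t, ht, hcov⟩ := hcpt.elim_nhds_subcover (fun x => Metric.ball x (δ x)) fun x hx =>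
    Metric.ball_mem_nhds x (hδ x fun h => hx.2 (hKU h))
  refine ⟨Set.Icc 0 M \ ⋃ x ∈ t, Metric.ball x (δ x), ?_, fun y hy => ?_, ?_⟩
  · exact isClosed_Icc.sdiff (isOpen_biUnion fun x _ => Metric.isOpen_ball)
  · by_contra hyU
    exact hy.2 (hcov ⟨hy.1, fun h => hyU (interior_subset h)⟩)
  · have h1 : ∀ᶠ n : ℕ+ in atTop, ∀ x ∈ t, ∀ j < (n : ℕ), δ x ≤ |s n j - x| :=
      (Filter.eventually_all_finset t).2 fun x hx => hsδ x fun h => (ht x hx).2 (hKU h)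
    filter_upwards [h1] with n hn j hj
    refine ⟨hs n j hj, fun h => ?_⟩
    simp only [Set.mem_iUnion, Metric.mem_ball, Real.dist_eq] at h
    obtain ⟨x, hx, hlt⟩ := h
    exact (hn x hx j hj).not_gt hlt

/-- The essential range of `|a|` lies in every closed set that eventually contains the singular
values of the finite sections: the distance to `V` is a test function with vanishing averages. -/
theorem ae_norm_mem_of_eventually_singularValues_mem (a : LInfty) {V : Set ℝ} (hV : IsClosed V)
    (h : ∀ᶠ n : ℕ+ in atTop, ∀ j < (n : ℕ),
      (finSection (toeplitz a) n).toLinearMap.singularValues j ∈ V) :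
    ∀ᵐ t ∂(AddCircle.haarAddCircle : Measure (AddCircle (2 * π))), ‖a t‖ ∈ V := by
  obtain ⟨n, hn⟩ := h.exists
  -- `V` is nonempty because `A_n` has at least one singular value; `infDist` to `∅` would be `0`.
  have hne : V.Nonempty := ⟨_, hn 0 n.pos⟩
  have hc : Continuous fun x : ℝ => Metric.infDist x V := Metric.continuous_infDist_pt V
  have h0 : ∫ t, Metric.infDist ‖a t‖ V ∂AddCircle.haarAddCircle = 0 := by
    refine tendsto_nhds_unique (tendsto_average_real a hc) (tendsto_const_nhds.congr' ?_)
    filter_upwards [h] with n hn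
    rw [Finset.sum_eq_zero fun j hj => Metric.infDist_zero_of_mem (hn j (Finset.mem_range.1 hj)),
      zero_div]
  rw [integral_eq_zero_iff_of_nonneg (fun _ => Metric.infDist_nonneg)
    (integrable_comp_norm a hc)] at h0
  filter_upwards [h0] with t ht
  exact (hV.mem_iff_infDist_zero hne).2 ht

/-! ### Passing from the circle to the interval `[0, 2π]` -/

theorem intervalIntegrable_of_integrable_haar {f : AddCircle (2 * π) → ℂ}
    (hf : Integrable f AddCircle.haarAddCircle) :
    IntervalIntegrable (fun t : ℝ => f t) volume 0 (2 * π) := by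
  have hf' : Integrable f volume := by
    rw [AddCircle.volume_eq_smul_haarAddCircle]
    exact hf.smul_measure ENNReal.ofReal_ne_top
  have h := (AddCircle.measurePreserving_mk (2 * π) 0).integrable_comp_of_integrable hf'
  rw [zero_add] at h
  exact (intervalIntegrable_iff_integrableOn_Ioc_of_le Real.two_pi_pos.le).2 h

theorem integral_haar_eq_intervalIntegral (f : AddCircle (2 * π) → ℂ) :
    ∫ t, f t ∂AddCircle.haarAddCircle
      = (1 / (2 * π) : ℂ) * ∫ t in (0 : ℝ)..(2 * π), f (t : AddCircle (2 * π)) := by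
  have h := AddCircle.intervalIntegral_preimage (2 * π) 0 f
  rw [zero_add] at h
  rw [h, AddCircle.volume_eq_smul_haarAddCircle, integral_smul_measure,
    ENNReal.toReal_ofReal Real.two_pi_pos.le, Complex.real_smul, ← mul_assoc]
  push_cast
  rw [one_div_mul_cancel (by exact_mod_cast Real.two_pi_pos.ne'), one_mul]

end

end FiniteSections

theorem corollary5p10
    (a : FiniteSections.LInfty) (g : ℝ → ℂ) (U : Set ℝ)
    (hU : U ∈ 𝓝ˢ {x : ℝ | (x : ℂ) ∈ FiniteSections.stabilitySpectrum
      (FiniteSections.absVal (FiniteSections.finSections (FiniteSections.toeplitz a)))})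
    (hg : ContinuousOn g U) :
    IntervalIntegrable (fun t : ℝ => g ‖a (t : AddCircle (2 * π))‖) volume 0 (2 * π) ∧
    Tendsto
      (fun n : ℕ+ =>
        (∑ j ∈ Finset.range n,
          g ((FiniteSections.finSection (FiniteSections.toeplitz a) n).toLinearMap.singularValues j))
          / (n : ℂ))
      atTop
      (𝓝 ((1 / (2 * π) : ℂ) * ∫ t in (0 : ℝ)..(2 * π), g ‖a (t : AddCircle (2 * π))‖)) := by
  open FiniteSections in
  obtain ⟨V, hVc, hVU, hV⟩ := exists_isClosed_eventually_mem hU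
    (s := fun n j => (finSection (toeplitz a) n).toLinearMap.singularValues j)
    (M := ‖toeplitz a‖)
    (fun n j hj => ⟨LinearMap.singularValues_nonneg _ j,
      (singularValues_le_norm _ hj).trans (norm_finSection_toeplitz_le a n)⟩)
    (fun x hx => eventually_le_abs_sub_of_notMem_stabilitySpectrum (finSections (toeplitz a)) hx)
  have haV := ae_norm_mem_of_eventually_singularValues_mem a hVc hV
  -- Only the values of `g` on `V` matter, so `g` may be replaced by a continuous extension `h`.
  obtain ⟨h, hh⟩ := ContinuousMap.exists_restrict_eq hVc
    ⟨V.domRestrict g, continuousOn_iff_continuous_domRestrict.1 (hg.mono hVU)⟩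
  have hgh : ∀ x ∈ V, h x = g x := fun x hx => DFunLike.congr_fun hh ⟨x, hx⟩
  have hae : (fun t => h ‖a t‖) =ᵐ[AddCircle.haarAddCircle] fun t => g ‖a t‖ := by
    filter_upwards [haV] with t ht using hgh _ ht
  refine ⟨intervalIntegrable_of_integrable_haar (f := fun t => g ‖a t‖)
    ((integrable_comp_norm a h.continuous).congr hae), ?_⟩
  rw [← integral_haar_eq_intervalIntegral fun t => g ‖a t‖, ← integral_congr_ae hae]
  refine (tendsto_average a h.continuous).congr' ?_
  filter_upwards [hV] with n hn
  rw [Finset.sum_congr rfl fun j hj => hgh _ (hn j (Finset.mem_range.1 hj))]
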